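/- All graphs are finite and simple. The clique-matrix of a graph $G$ is the $\{0,1\}$-matrix whose columns are indexed by the vertices of $G$ and whose rows are the incidence vectors of the (inclusion-wise) maximal cliques of $G$. A $\{0,1\}$-matrix is balanced if it contains no square submatrix of odd order having exactly two $1$'s in each row and in each column; $G$ is balanced if its clique-matrix is balanced. $G$ is diamond-free if it has no induced copy of the diamond $K_4-e$. An odd hole is an induced cycle $C_n$ with $n\ge 4$ odd. A multisun is a diamond-free graph $G$ of odd order $n\geq 3$ whose maximal cliques of size $2$ are exactly the edges of a Hamiltonian cycle $C$ of $G$, called the rim, and whose remaining maximal cliques (possibly none), called the inscribed cliques, consist of pairwise nonconsecutive vertices of $C$. A sub-multisun of $G$ is a graph obtained from $G$ by removing the edge sets of some, but not all, inscribed cliques (possibly of none of them). For not necessarily distinct inscribed cliques $A,B$ of a multisun $G$, an $AB$-path is a subpath of the rim with two distinct endpoints, one in $A$ and the other in $B$, none of whose inner vertices belongs to an inscribed clique; an $A$-path is an $AA$-path; for a vertex $v$ of some inscribed clique $B$, an $Av$-path is an $AB$-path whose endpoint in $B$ is $v$. A multisun $G$ satisfies the N-conditions if there is a vertex $\xi$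 such that: 1. for each inscribed clique $A$, the number of vertices of each $A$-path is even and at least $4$; 2. each inscribed clique has an odd number of vertices; 3. $A\cap B=\{\xi\}$ for any two distinct inscribed cliques $A,B$; 4. for each inscribed clique $A$, every $A\xi$-path has an even number of vertices; 5. for any two distinct inscribed cliques $A,B$, every $AB$-path neither of whose endpoints is $\xi$ has an odd number of vertices. A sunoid is a multisun $G$ such that $G$ and each of its sub-multisuns satisfy the N-conditions. **Theorem.** Let $G$ be a diamond-free graph. Then $G$ is not balanced if and only if $G$ contains an odd hole or a sunoid as an induced subgraph. -/

import Mathlib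

/-- A `{0,1}`-matrix is balanced if it has no square submatrix of odd order with exactly two
`1`'s in each row and in each column. -/
def Matrix.IsBalanced {m n : Type*} (A : Matrix m n ℤ) : Prop :=
  ¬ ∃ (k : ℕ) (r : Fin k ↪ m) (c : Fin k ↪ n), Odd k ∧
    (∀ i, (Finset.univ.filter fun j => A.submatrix r c i j = 1).card = 2) ∧
    (∀ j, (Finset.univ.filter fun i => A.submatrix r c i j = 1).card = 2)

namespace SimpleGraph

/-- The diamond `K₄ - e`. -/
def diamond : SimpleGraph (Fin 4) := (⊤ : SimpleGraph (Fin 4)).deleteEdges {s(0, 1)}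

/-- No induced subgraph is a diamond. -/
def IsDiamondFree {V : Type*} (G : SimpleGraph V) : Prop := ¬ diamond.IsIndContained G

/-- The maximal cliques of `G`, as sets of vertices. -/
def maximalCliques {V : Type*} (G : SimpleGraph V) : Set (Set V) := {K | Maximal G.IsClique K}

open Classical in
/-- The clique-matrix: rows are the incidence vectors of the maximal cliques, columns are indexed
by the vertices. -/
noncomputable def cliqueMatrix {V : Type*} (G : SimpleGraph V) : Matrix G.maximalCliques V ℤ :=
  Matrix.of fun K v => if v ∈ K.1 then 1 else 0

/-- A graph is balanced if its clique-matrix is balanced. -/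
def IsBalanced {V : Type*} (G : SimpleGraph V) : Prop := G.cliqueMatrix.IsBalanced

/-- `G` contains an odd hole, that is, an induced copy of `Cₙ` with `n ≥ 4` odd. -/
def ContainsOddHole {V : Type*} (G : SimpleGraph V) : Prop :=
  ∃ n : ℕ, 4 ≤ n ∧ Odd n ∧ (cycleGraph n).IsIndContained G

/-- The spanning subgraph of `G` whose edges are the maximal cliques of size 2. -/
def rim {V : Type*} (G : SimpleGraph V) : SimpleGraph V where
  Adj u v := u ≠ v ∧ {u, v} ∈ G.maximalCliques
  symm := ⟨fun u v h => ⟨h.1.symm, Set.pair_comm u v ▸ h.2⟩⟩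
  loopless := ⟨fun _ h => h.1 rfl⟩

/-- The inscribed cliques: the maximal cliques other than those of size 2. -/
def inscribedCliques {V : Type*} (G : SimpleGraph V) : Set (Set V) :=
  {K | K ∈ G.maximalCliques ∧ K.ncard ≠ 2}

/-- A multisun: a diamond-free graph of odd order whose maximal cliques of size 2 form a
Hamiltonian cycle (the rim), the remaining maximal cliques consisting of pairwise nonconsecutive
vertices of the rim. -/
structure IsMultisun {V : Type*} (G : SimpleGraph V) : Prop where
  diamondFree : G.IsDiamondFree
  odd_card : Odd (Nat.card V)
  three_le_card : 3 ≤ Nat.card V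
  rim_cycle : Nonempty (cycleGraph (Nat.card V) ≃g G.rim)
  nonconsecutive : ∀ K ∈ G.inscribedCliques, ∀ u ∈ K, ∀ v ∈ K, ¬ G.rim.Adj u v

/-- The partial subgraph of `G` obtained by removing the edge sets of the cliques in `R`. -/
def removeCliques {V : Type*} (G : SimpleGraph V) (R : Set (Set V)) : SimpleGraph V :=
  G.deleteEdges {e | ∃ K ∈ R, ∀ v ∈ e, v ∈ K}

/-- `H` is a sub-multisun of `G`: it arises from `G` by removing the edge sets of some, but not
all, inscribed cliques. -/
def IsSubMultisun {V : Type*} (H G : SimpleGraph V) : Prop :=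
  ∃ R : Set (Set V), R ⊂ G.inscribedCliques ∧ H = G.removeCliques R

/-- An `AB`-path: a subpath of the rim with distinct endpoints, one in `A` and the other in `B`,
whose inner vertices are in no inscribed clique. -/
structure IsCliquePath {V : Type*} (G : SimpleGraph V) (A B : Set V) {u v : V}
    (P : G.rim.Walk u v) : Prop where
  isPath : P.IsPath
  ne : u ≠ v
  left_mem : u ∈ A
  right_mem : v ∈ B
  inner : ∀ w ∈ P.support, w ≠ u → w ≠ v → ∀ K ∈ G.inscribedCliques, w ∉ K

/-- The N-conditions with common vertex `ξ`. The number of vertices of a path `P` is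
`P.support.length`. -/
structure NConditionsAt {V : Type*} (G : SimpleGraph V) (ξ : V) : Prop where
  n1 : ∀ A ∈ G.inscribedCliques, ∀ (u v : V) (P : G.rim.Walk u v),
    G.IsCliquePath A A P → Even P.support.length ∧ 4 ≤ P.support.length
  n2 : ∀ A ∈ G.inscribedCliques, Odd A.ncard
  n3 : ∀ A ∈ G.inscribedCliques, ∀ B ∈ G.inscribedCliques, A ≠ B → A ∩ B = {ξ}
  n4 : ∀ A ∈ G.inscribedCliques, ∀ B ∈ G.inscribedCliques, ∀ (u : V) (P : G.rim.Walk u ξ),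
    G.IsCliquePath A B P → Even P.support.length
  /-- For distinct cliques the endpoints of the path lie in only one of the two cliques, i.e. they
  differ from `ξ` (paths ending at `ξ` are the subject of the fourth condition). -/
  n5 : ∀ A ∈ G.inscribedCliques, ∀ B ∈ G.inscribedCliques, A ≠ B →
    ∀ (u v : V) (P : G.rim.Walk u v), G.IsCliquePath A B P → u ≠ ξ → v ≠ ξ →
      Odd P.support.length

/-- The N-conditions for a multisun `G`. -/
def NConditions {V : Type*} (G : SimpleGraph V) : Prop := ∃ ξ : V, G.NConditionsAt ξ

/-- A sunoid: a multisun that satisfies the N-conditions together with each of its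
sub-multisuns. -/
def IsSunoid {V : Type*} (G : SimpleGraph V) : Prop :=
  G.IsMultisun ∧ G.NConditions ∧ ∀ H : SimpleGraph V, H.IsSubMultisun G → H.NConditions

end SimpleGraph

/-!
Call a cycle tight if none of its edges lies in a triangle of the subgraph induced by its vertices.
In a diamond-free graph every edge lies in exactly one maximal clique, which consists of its ends
and their common neighbours; hence an odd tight cycle is the same thing as an odd submatrix of the
clique-matrix with two ones in each row and column whose bipartite graph is connected, and `G` is
unbalanced if and only if it has an odd tight cycle
(`IsDiamondFree.exists_isTightCycle_of_not_isBalanced`, `not_isBalanced_of_cycle`). Odd holes and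
rims of induced multisuns are odd tight cycles, which is one direction.

For the other, take a shortest odd tight cycle, the rim, and the subgraph induced by its vertices
(`IsMinimalRim`). Segments of the rim and chords inside cliques form shorter tight cycles, which are
even (`IsMinimalRim.even_of_segments` and its variants). This parity constraint gives everything: a
maximal clique of size two is a rim edge; consecutive vertices of an inscribed clique `A` are joined
by an odd number of rim edges (`IsMinimalRim.odd_of_gap`), and as the rim is odd so is the order of
`A` (`IsMinimalRim.odd_ncard`); disjoint inscribed cliques are impossible, by a count of the
vertices of one in the gaps of the other (`IsMinimalRim.not_disjoint`); all inscribed cliques share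
a vertex `ξ` because a diamond-free graph has the Helly property for pairwise intersecting maximal
cliques (`IsMinimalRim.exists_common_vertex`); and a segment between two inscribed cliques that
avoids `ξ` closes up through `ξ` (`IsMinimalRim.even_of_segment_between`). These arguments involve
one or two cliques at a time, and the inscribed cliques of a sub-multisun are among those of the
graph, so the N-conditions hold for all sub-multisuns with the same `ξ`
(`IsMinimalRim.nConditions_removeCliques`).
-/

/-! ### Last and first indices with a property -/

theorem Nat.exists_last_of_lt {p : ℕ → Prop} {i q : ℕ} (hiq : i < q) (hi : p i) :
    ∃ x, i ≤ x ∧ x < q ∧ p x ∧ ∀ t, x < t → t < q → ¬ p t := by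
  induction q with
  | zero => omega
  | succ q ih =>
    by_cases hq : p q
    · exact ⟨q, by omega, by omega, hq, fun t h1 h2 => by omega⟩
    · have hne : i ≠ q := fun h => hq (h ▸ hi)
      obtain ⟨x, h1, h2, h3, h4⟩ := ih (by omega)
      refine ⟨x, h1, by omega, h3, fun t h5 h6 => ?_⟩
      rcases (Nat.lt_succ_iff.1 h6).eq_or_lt with rfl | h
      exacts [hq, h4 t h5 h]

theorem Nat.exists_first_of_lt {p : ℕ → Prop} {i q : ℕ} (hiq : i < q) (hq : p q) :
    ∃ x, i < x ∧ x ≤ q ∧ p x ∧ ∀ t, i < t → t < x → ¬ p t := by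
  classical
  have h : ∃ x, i < x ∧ p x := ⟨q, hiq, hq⟩
  refine ⟨Nat.find h, (Nat.find_spec h).1, Nat.find_min' h ⟨hiq, hq⟩, (Nat.find_spec h).2, ?_⟩
  exact fun t h1 h2 h3 => Nat.find_min h h2 ⟨h1, h3⟩

namespace SimpleGraph

/-! ### Maximal cliques of diamond-free graphs -/

section MaximalCliques

variable {V : Type*} {G : SimpleGraph V}

theorem IsDiamondFree.adj (hG : G.IsDiamondFree) {a b x y : V} (hab : G.Adj a b)
    (hxa : G.Adj x a) (hxb : G.Adj x b) (hya : G.Adj y a) (hyb : G.Adj y b) (hxy : x ≠ y) :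
    G.Adj x y := by
  by_contra hn
  apply hG
  refine ⟨⟨⟨![x, y, a, b], ?_⟩, ?_⟩⟩
  · intro i j hij
    have h1 := hab.ne
    have h2 := hxa.ne
    have h3 := hxb.ne
    have h4 := hya.ne
    have h5 := hyb.ne
    fin_cases i <;> fin_cases j <;> simp_all
  · intro i j
    have hn' : ¬ G.Adj y x := fun h => hn h.symm
    change G.Adj (![x, y, a, b] i) (![x, y, a, b] j) ↔ _
    fin_cases i <;> fin_cases j <;>
      simp [diamond, hab, hab.symm, hxa, hxa.symm, hxb, hxb.symm, hya, hya.symm, hyb, hyb.symm,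
        hn, hn']

theorem IsDiamondFree.induce (hG : G.IsDiamondFree) (S : Set V) : (G.induce S).IsDiamondFree :=
  fun ⟨f⟩ => hG ⟨f.trans (Embedding.induce S)⟩

theorem exists_mem_maximalCliques [Finite V] {K : Set V} (hK : G.IsClique K) :
    ∃ M ∈ G.maximalCliques, K ⊆ M := by
  obtain ⟨M, hKM, hM⟩ := Finite.exists_le_maximal (p := fun K : Set V => G.IsClique K) hK
  exact ⟨M, hM, hKM⟩

theorem exists_mem_maximalCliques_of_adj [Finite V] {u v : V} (h : G.Adj u v) :
    ∃ M ∈ G.maximalCliques, u ∈ M ∧ v ∈ M := by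
  obtain ⟨M, hM, hs⟩ := exists_mem_maximalCliques (G := G) (K := {u, v})
    (by rw [isClique_pair]; exact fun _ => h)
  exact ⟨M, hM, hs (by simp), hs (by simp)⟩

theorem adj_of_mem_maximalCliques {K : Set V} (hK : K ∈ G.maximalCliques) {u v : V} (hu : u ∈ K)
    (hv : v ∈ K) (huv : u ≠ v) : G.Adj u v := hK.1 hu hv huv

theorem mem_of_forall_adj {K : Set V} (hK : K ∈ G.maximalCliques) {z : V}
    (h : ∀ x ∈ K, z ≠ x → G.Adj z x) : z ∈ K :=
  hK.2 (hK.1.insert h) (Set.subset_insert z K) (Set.mem_insert z K)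

theorem pair_mem_maximalCliques {u v : V} (h : G.Adj u v)
    (hn : ∀ z, G.Adj u z → ¬ G.Adj v z) : {u, v} ∈ G.maximalCliques := by
  refine ⟨by rw [isClique_pair]; exact fun _ => h, fun M hM hs z hz => ?_⟩
  by_contra hzz
  simp only [Set.mem_insert_iff, Set.mem_singleton_iff, not_or] at hzz
  exact hn z (hM (hs (by simp)) hz (Ne.symm hzz.1)) (hM (hs (by simp)) hz (Ne.symm hzz.2))

theorem not_adj_of_pair_mem_maximalCliques {u v : V} (hne : u ≠ v)
    (h : {u, v} ∈ G.maximalCliques) {z : V} (hu : G.Adj u z) : ¬ G.Adj v z := by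
  intro hv
  have hz : z ∈ ({u, v} : Set V) := by
    refine mem_of_forall_adj h fun x hx _ => ?_
    rcases hx with rfl | rfl
    exacts [hu.symm, hv.symm]
  rcases hz with rfl | rfl
  exacts [hu.ne rfl, hv.ne rfl]

/-- In a diamond-free graph a maximal clique contains all common neighbours of any two of its
vertices. -/
theorem IsDiamondFree.mem_of_adj_of_adj (hG : G.IsDiamondFree) {K : Set V}
    (hK : K ∈ G.maximalCliques) {u v z : V} (hu : u ∈ K) (hv : v ∈ K) (huv : u ≠ v)
    (hzu : G.Adj z u) (hzv : G.Adj z v) : z ∈ K := by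
  refine mem_of_forall_adj hK fun x hx hzx => ?_
  by_cases hxu : x = u
  · exact hxu ▸ hzu
  by_cases hxv : x = v
  · exact hxv ▸ hzv
  exact hG.adj (hK.1 hu hv huv) hzu hzv (hK.1 hx hu hxu) (hK.1 hx hv hxv) hzx

theorem IsDiamondFree.eq_of_mem (hG : G.IsDiamondFree) {K L : Set V} (hK : K ∈ G.maximalCliques)
    (hL : L ∈ G.maximalCliques) {u v : V} (huv : u ≠ v) (huK : u ∈ K) (hvK : v ∈ K) (huL : u ∈ L)
    (hvL : v ∈ L) : K = L := by
  have key : ∀ {K L : Set V}, K ∈ G.maximalCliques → L ∈ G.maximalCliques → u ∈ K → v ∈ K →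
      u ∈ L → v ∈ L → K ⊆ L := by
    intro K L hK hL huK hvK huL hvL x hx
    by_cases hxu : x = u
    · exact hxu ▸ huL
    by_cases hxv : x = v
    · exact hxv ▸ hvL
    exact hG.mem_of_adj_of_adj hL huL hvL huv (hK.1 hx huK hxu) (hK.1 hx hvK hxv)
  exact (key hK hL huK hvK huL hvL).antisymm (key hL hK huL hvL huK hvK)

/-- Helly property: pairwise intersecting maximal cliques of a diamond-free graph have a common
vertex, since vertices of the pairwise intersections would form a triangle. -/
theorem IsDiamondFree.mem_of_inter [Finite V] (hG : G.IsDiamondFree) {A B C : Set V}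
    (hA : A ∈ G.maximalCliques) (hB : B ∈ G.maximalCliques) (hC : C ∈ G.maximalCliques)
    (hAB : A ≠ B) {x : V} (hxA : x ∈ A) (hxB : x ∈ B) (hAC : (A ∩ C).Nonempty)
    (hBC : (B ∩ C).Nonempty) : x ∈ C := by
  obtain ⟨y, hyA, hyC⟩ := hAC
  obtain ⟨z, hzB, hzC⟩ := hBC
  by_contra hx
  have hxy : x ≠ y := fun h => hx (h ▸ hyC)
  have hxz : x ≠ z := fun h => hx (h ▸ hzC)
  by_cases hyz : y = z
  · subst hyz
    exact hAB (hG.eq_of_mem hA hB hxy hxA hyA hxB hzB)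
  have hzA := hG.mem_of_adj_of_adj hA hxA hyA hxy (hB.1 hzB hxB hxz.symm)
    (hC.1 hzC hyC (Ne.symm hyz))
  exact hAB (hG.eq_of_mem hA hB hxz hxA hzA hxB hzB)

end MaximalCliques

section RemoveCliques

variable {V : Type*} {G : SimpleGraph V} {R : Set (Set V)}

theorem removeCliques_adj {u v : V} :
    (G.removeCliques R).Adj u v ↔ G.Adj u v ∧ ∀ K ∈ R, u ∈ K → v ∉ K := by
  simp [removeCliques, deleteEdges_adj]

theorem removeCliques_empty : G.removeCliques ∅ = G := by
  ext u v
  simp [removeCliques_adj]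

end RemoveCliques

/-! ### Tight cycles -/

section TightCycles

variable {V : Type*} {G : SimpleGraph V}

/-- Two adjacent vertices without a common neighbour in `S`. -/
def TightAdj (G : SimpleGraph V) (S : Set V) (x y : V) : Prop :=
  G.Adj x y ∧ ∀ z ∈ S, G.Adj x z → ¬ G.Adj y z

theorem TightAdj.symm {S : Set V} {x y : V} (h : G.TightAdj S x y) : G.TightAdj S y x :=
  ⟨h.1.symm, fun z hz h1 h2 => h.2 z hz h2 h1⟩

/-- The list `l` enumerates, in cyclic order, the vertices of a cycle of `G` none of whose edges
lies in a triangle of the subgraph induced by the vertices of `l`. -/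
structure IsTightCycle (G : SimpleGraph V) (l : List V) : Prop where
  nodup : l.Nodup
  chain : l.IsChain (G.TightAdj {z | z ∈ l})
  closed : ∀ x ∈ l.getLast?, ∀ y ∈ l.head?, G.TightAdj {z | z ∈ l} x y

theorem IsTightCycle.three_le {l : List V} (hl : G.IsTightCycle l) (ho : Odd l.length) :
    3 ≤ l.length := by
  match l with
  | [] => simp at ho
  | [a] => exact absurd (hl.closed a (by simp) a (by simp)).1 (G.loopless.irrefl a)
  | [a, b] => simp at ho; exact absurd ho (by decide)
  | _ :: _ :: _ :: _ => simp

theorem IsTightCycle.map_induce {S : Set V} {l : List S} (hl : (G.induce S).IsTightCycle l) :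
    G.IsTightCycle (l.map Subtype.val) := by
  have key : ∀ a b : S, (G.induce S).TightAdj {z | z ∈ l} a b →
      G.TightAdj {z | z ∈ l.map Subtype.val} a b := by
    intro a b h
    refine ⟨h.1, fun z hz h1 h2 => ?_⟩
    simp only [Set.mem_ofPred_eq, List.mem_map] at hz
    obtain ⟨z, hz, rfl⟩ := hz
    exact h.2 z hz h1 h2
  refine ⟨hl.nodup.map Subtype.val_injective, List.isChain_map_of_isChain _ key hl.chain, ?_⟩
  intro x hx y hy
  simp only [List.getLast?_map, List.head?_map, Option.mem_map] at hx hy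
  obtain ⟨x, hx, rfl⟩ := hx
  obtain ⟨y, hy, rfl⟩ := hy
  exact key _ _ (hl.closed x hx y hy)

/-- An unbalanced diamond-free graph has a tight cycle of odd length: the columns of the odd
submatrix, two of them being joined when they share a row, form a 2-regular graph of odd order,
one of whose components is an odd cycle. -/
theorem IsDiamondFree.exists_isTightCycle_of_not_isBalanced (hG : G.IsDiamondFree)
    (h : ¬ G.IsBalanced) : ∃ l : List V, G.IsTightCycle l ∧ Odd l.length := by
  classical
  simp only [IsBalanced, Matrix.IsBalanced, not_not] at h
  obtain ⟨k, r, c, hk, hr, hc⟩ := h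
  have hM : ∀ i j, G.cliqueMatrix.submatrix r c i j = 1 ↔ c j ∈ (r i).1 := by
    intro i j
    simp [cliqueMatrix]
  simp only [hM] at hr hc
  let D : SimpleGraph (Fin k) :=
    { Adj := fun a b => a ≠ b ∧ ∃ i, c a ∈ (r i).1 ∧ c b ∈ (r i).1
      symm := ⟨fun a b h => ⟨h.1.symm, h.2.imp fun i hi => ⟨hi.2, hi.1⟩⟩⟩
      loopless := ⟨fun a h => h.1 rfl⟩ }
  -- Two rows cannot share two columns, so each column has exactly two neighbours in `D`.
  have hrow : ∀ {a b i i'}, a ≠ b → c a ∈ (r i).1 → c b ∈ (r i).1 → c a ∈ (r i').1 →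
      c b ∈ (r i').1 → i = i' := by
    intro a b i i' hab h1 h2 h3 h4
    exact r.injective (Subtype.ext (hG.eq_of_mem (r i).2 (r i').2
      (fun h => hab (c.injective h)) h1 h2 h3 h4))
  have hother : ∀ {i a}, c a ∈ (r i).1 → ∃ b, b ≠ a ∧ ∀ x, c x ∈ (r i).1 ↔ x = a ∨ x = b := by
    intro i a ha
    obtain ⟨x, y, hxy, he⟩ := Finset.card_eq_two.1 (hr i)
    have hm : ∀ z, c z ∈ (r i).1 ↔ z = x ∨ z = y := by
      intro z
      have := Finset.ext_iff.1 he z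
      simpa using this
    rcases (hm a).1 ha with rfl | rfl
    · exact ⟨y, hxy.symm, hm⟩
    · exact ⟨x, hxy, fun z => (hm z).trans or_comm⟩
  have htight : ∀ {a b}, D.Adj a b → G.TightAdj (Set.range c) (c a) (c b) := by
    rintro a b ⟨hab, i, ha, hb⟩
    have hne : c a ≠ c b := fun h => hab (c.injective h)
    refine ⟨(r i).2.1 ha hb hne, ?_⟩
    rintro _ ⟨z, rfl⟩ h1 h2
    have hz := hG.mem_of_adj_of_adj (r i).2 ha hb hne h1.symm h2.symm
    obtain ⟨b', -, hm⟩ := hother ha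
    have hbb : b = b' := ((hm b).1 hb).resolve_left (Ne.symm hab)
    rcases (hm z).1 hz with rfl | rfl
    · exact h1.ne rfl
    · exact h2.ne (by rw [hbb])
  have hcyc : D.IsCycles := by
    intro a _
    obtain ⟨i, i', hii, he⟩ := Finset.card_eq_two.1 (hc a)
    have hm : ∀ z, c a ∈ (r z).1 ↔ z = i ∨ z = i' := by
      intro z
      have := Finset.ext_iff.1 he z
      simpa using this
    have hi := (hm i).2 (Or.inl rfl)
    have hi' := (hm i').2 (Or.inr rfl)
    obtain ⟨b, hba, hb⟩ := hother hi
    obtain ⟨b', hba', hb'⟩ := hother hi'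
    have hcb := (hb b).2 (Or.inr rfl)
    have hcb' := (hb' b').2 (Or.inr rfl)
    refine Set.ncard_eq_two.2 ⟨b, b', ?_, ?_⟩
    · rintro rfl
      exact hii (hrow hba.symm hi hcb hi' hcb')
    · ext z
      simp only [mem_neighborSet, Set.mem_insert_iff, Set.mem_singleton_iff]
      constructor
      · rintro ⟨haz, j, h1, h2⟩
        rcases (hm j).1 h1 with rfl | rfl
        · exact Or.inl (((hb z).1 h2).resolve_left haz.symm)
        · exact Or.inr (((hb' z).1 h2).resolve_left haz.symm)
      · rintro (rfl | rfl)
        · exact ⟨hba.symm, i, hi, hcb⟩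
        · exact ⟨hba'.symm, i', hi', hcb'⟩
  have hodd : Odd D.oddComponents.ncard := (odd_ncard_oddComponents D).2 (by simpa using hk)
  obtain ⟨C, hC⟩ : D.oddComponents.Nonempty := by
    rw [← Set.ncard_pos]
    exact hodd.pos
  obtain ⟨v, hv⟩ := C.nonempty_supp
  have hnb : (D.neighborSet v).Nonempty := by
    obtain ⟨i, hi⟩ := Finset.card_pos.1 (by rw [hc v]; norm_num :
      0 < (Finset.univ.filter fun i => c v ∈ (r i).1).card)
    have hi : c v ∈ (r i).1 := by simpa using hi
    obtain ⟨b, hb, hm⟩ := hother hi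
    exact ⟨b, hb.symm, i, hi, (hm b).2 (Or.inr rfl)⟩
  obtain ⟨p, hp, hverts⟩ := hcyc.exists_cycle_toSubgraph_verts_eq_connectedComponentSupp hv hnb
  have hlen : Odd p.support.tail.length := by
    have h1 : C.supp = {z | z ∈ p.support.tail} := by
      rw [← hverts]
      ext z
      simp only [Walk.mem_verts_toSubgraph, Set.mem_ofPred_eq]
      exact (Walk.mem_support_iff _).trans
        ⟨fun h => h.elim (fun h => h ▸ Walk.end_mem_tail_support hp.not_nil) id, Or.inr⟩
    have h2 : C.supp = (p.support.tail.toFinset : Set (Fin k)) := by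
      rw [h1]; ext; simp
    have h3 : Odd C.supp.ncard := hC
    rwa [h2, Set.ncard_coe_finset, List.toFinset_card_of_nodup hp.support_nodup] at h3
  have hmono : ∀ {a b}, D.Adj a b →
      G.TightAdj {z | z ∈ p.support.tail.map c} (c a) (c b) := by
    intro a b hab
    refine ⟨(htight hab).1, fun z hz => (htight hab).2 z ?_⟩
    simp only [Set.mem_ofPred_eq, List.mem_map] at hz
    obtain ⟨z, -, rfl⟩ := hz
    exact ⟨z, rfl⟩
  refine ⟨p.support.tail.map c, ⟨hp.support_nodup.map c.injective, ?_, ?_⟩, by simpa using hlen⟩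
  · exact List.isChain_map_of_isChain c (fun _ _ h => hmono h) p.isChain_adj_support.tail
  · cases p with
    | nil => simp at hlen
    | @cons _ u _ hvw q =>
      intro x hx y hy
      simp only [Walk.support_cons, List.tail_cons] at hx hy
      have h1 : q.support.getLast? = some v := by
        rw [List.getLast?_eq_some_getLast q.support_ne_nil, Walk.getLast_support]
      have h2 : q.support.head? = some u := by
        rw [List.head?_eq_some_head q.support_ne_nil, Walk.head_support]
      simp only [List.getLast?_map, List.head?_map, h1, h2, Option.map_some, Option.mem_def,
        Option.some.injEq] at hx hy
      subst hx hy
      exact hmono hvw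

end TightCycles

/-! ### Minimal odd tight cycles -/

/-- The periodic sequence `w` runs along an odd tight cycle of length `n` through all vertices of
the diamond-free graph `G`, and no odd tight cycle of `G` is shorter. -/
structure IsMinimalRim {V : Type*} (G : SimpleGraph V) (n : ℕ) (w : ℕ → V) : Prop where
  diamondFree : G.IsDiamondFree
  odd : Odd n
  three_le : 3 ≤ n
  eq_iff : ∀ i j, w i = w j ↔ i % n = j % n
  surj : Function.Surjective w
  adj : ∀ i, G.Adj (w i) (w (i + 1))
  not_adj : ∀ i z, G.Adj (w i) z → ¬ G.Adj (w (i + 1)) z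
  minimal : ∀ l, G.IsTightCycle l → Odd l.length → n ≤ l.length

namespace IsMinimalRim

variable {V : Type*} {G : SimpleGraph V} {n : ℕ} {w : ℕ → V}

theorem eq_of_lt (hw : G.IsMinimalRim n w) {i s t : ℕ} (his : i ≤ s) (hs : s < i + n)
    (hit : i ≤ t) (ht : t < i + n) (h : w s = w t) : s = t := by
  have h := (hw.eq_iff s t).1 h
  have key : ∀ {s t : ℕ}, i ≤ s → t < i + n → s ≤ t → s % n = t % n → s = t := by
    intro s t h1 h2 h3 h4
    have h5 : (t - s) % n = 0 := Nat.sub_mod_eq_zero_of_mod_eq h4.symm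
    rw [Nat.mod_eq_of_lt (by omega)] at h5
    omega
  rcases le_total s t with hst | hst
  · exact key his ht hst h
  · exact (key hit hs hst h.symm).symm

theorem add_period (hw : G.IsMinimalRim n w) (i : ℕ) : w (i + n) = w i := by
  rw [hw.eq_iff]; simp

theorem exists_index (hw : G.IsMinimalRim n w) (i : ℕ) (z : V) :
    ∃ t, i ≤ t ∧ t < i + n ∧ w t = z := by
  obtain ⟨m, rfl⟩ := hw.surj z
  have hn := hw.three_le
  have h1 := Nat.mod_lt (m + n * i - i) (by omega : 0 < n)
  refine ⟨i + (m + n * i - i) % n, by omega, by omega, ?_⟩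
  rw [hw.eq_iff, Nat.add_mod_mod]
  have h2 : i ≤ n * i := Nat.le_mul_of_pos_left i (by omega)
  rw [show i + (m + n * i - i) = m + n * i by omega]
  simp

theorem tightAdj_succ (hw : G.IsMinimalRim n w) (S : Set V) (i : ℕ) :
    G.TightAdj S (w i) (w (i + 1)) := ⟨hw.adj i, fun z _ => hw.not_adj i z⟩

/-- The vertices of the segment of the rim with indices from `i` to `j`. -/
def segment (w : ℕ → V) (i j : ℕ) : List V := (List.range' i (j + 1 - i)).map w

theorem mem_segment {i j : ℕ} {z : V} : z ∈ segment w i j ↔ ∃ t, i ≤ t ∧ t ≤ j ∧ w t = z := by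
  simp only [segment, List.mem_map, List.mem_range'_1]
  constructor
  · rintro ⟨t, h, rfl⟩
    exact ⟨t, h.1, by omega, rfl⟩
  · rintro ⟨t, h1, h2, rfl⟩
    exact ⟨t, ⟨h1, by omega⟩, rfl⟩

theorem length_segment (i j : ℕ) : (segment w i j).length = j + 1 - i := by simp [segment]

theorem head?_segment {i j : ℕ} (h : i ≤ j) : (segment w i j).head? = some (w i) := by
  simp only [segment, List.head?_map, List.head?_range']
  rw [if_neg (by omega)]; rfl

theorem getLast?_segment {i j : ℕ} (h : i ≤ j) : (segment w i j).getLast? = some (w j) := by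
  simp only [segment, List.getLast?_map, List.getLast?_range']
  rw [if_neg (by omega)]
  simp only [Option.map_some]
  congr 2; omega

theorem nodup_segment (hw : G.IsMinimalRim n w) {i j : ℕ} (h : j < i + n) :
    (segment w i j).Nodup := by
  refine List.Nodup.map_on ?_ List.nodup_range'
  intro s hs t ht hst
  rw [List.mem_range'_1] at hs ht
  exact hw.eq_of_lt hs.1 (by omega) ht.1 (by omega) hst

theorem isChain_segment (hw : G.IsMinimalRim n w) (S : Set V) (i j : ℕ) :
    (segment w i j).IsChain (G.TightAdj S) := by
  refine List.isChain_map_of_isChain (R := fun a b => b = a + 1) w ?_ (List.isChain_range' i _ 1)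
  rintro a _ rfl
  exact hw.tightAdj_succ S a

/-- By minimality, a tight cycle that consists of a segment of the rim and a list `Q` and omits a
vertex has even length. -/
theorem even_of_segment_append (hw : G.IsMinimalRim n w) {i j : ℕ} (hij : i ≤ j) {Q : List V}
    {S : Set V} (hS : ∀ z, z ∈ segment w i j ∨ z ∈ Q → z ∈ S) (hQ : Q ≠ []) (hnd : Q.Nodup)
    (hd : ∀ z ∈ segment w i j, z ∉ Q) (hc : Q.IsChain (G.TightAdj S))
    (hhead : ∀ x ∈ Q.head?, G.TightAdj S (w j) x) (hlast : ∀ x ∈ Q.getLast?, G.TightAdj S x (w i))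
    (hlen : j + 1 - i + Q.length < n) : Even (j + 1 - i + Q.length) := by
  by_contra hodd
  rw [Nat.not_even_iff_odd] at hodd
  have hmono : ∀ {a b}, G.TightAdj S a b → G.TightAdj {z | z ∈ segment w i j ++ Q} a b :=
    fun h => ⟨h.1, fun z hz => h.2 z (hS z (List.mem_append.1 hz))⟩
  have hl : (segment w i j ++ Q).length = j + 1 - i + Q.length := by
    rw [List.length_append, length_segment]
  have := hw.minimal (segment w i j ++ Q) ⟨?_, ?_, ?_⟩ (hl ▸ hodd)
  · omega
  · rw [List.nodup_append']
    exact ⟨hw.nodup_segment (by omega), hnd, hd⟩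
  · rw [List.isChain_append]
    refine ⟨hw.isChain_segment _ i j, hc.imp fun _ _ h => hmono h, ?_⟩
    intro x hx y hy
    rw [getLast?_segment hij] at hx
    cases hx
    exact hmono (hhead y hy)
  · intro x hx y hy
    rw [List.getLast?_append_of_ne_nil _ hQ] at hx
    rw [List.head?_append, head?_segment hij] at hy
    cases hy
    exact hmono (hlast x hx)

/-- The vertices of two segments of the rim. -/
def segments (w : ℕ → V) (i j k l : ℕ) : Set V :=
  {z | ∃ t, (i ≤ t ∧ t ≤ j ∨ k ≤ t ∧ t ≤ l) ∧ w t = z}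

/-- Two disjoint segments, joined by two tight chords from the end of each to the start of the
other. -/
theorem even_of_segments (hw : G.IsMinimalRim n w) {i j k l : ℕ} (hij : i ≤ j) (hjk : j < k)
    (hkl : k ≤ l) (hli : l < i + n) (hlen : j + l + 2 < n + i + k)
    (h1 : G.TightAdj (segments w i j k l) (w j) (w k))
    (h2 : G.TightAdj (segments w i j k l) (w l) (w i)) : Even (i + j + k + l) := by
  have := hw.even_of_segment_append hij (Q := segment w k l) (S := segments w i j k l) ?_ ?_ ?_ ?_
    (hw.isChain_segment _ _ _) ?_ ?_ ?_
  · rw [length_segment] at this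
    rw [Nat.even_iff] at this ⊢
    omega
  · rintro z (hz | hz) <;> obtain ⟨t, h, h', rfl⟩ := mem_segment.1 hz
    · exact ⟨t, Or.inl ⟨h, h'⟩, rfl⟩
    · exact ⟨t, Or.inr ⟨h, h'⟩, rfl⟩
  · rw [← List.length_pos_iff, length_segment]; omega
  · exact hw.nodup_segment (by omega)
  · intro z hz hz'
    obtain ⟨s, hs, hs', rfl⟩ := mem_segment.1 hz
    obtain ⟨t, ht, ht', h⟩ := mem_segment.1 hz'
    have := hw.eq_of_lt (i := i) (by omega) (by omega) hs (by omega) h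
    omega
  · rw [head?_segment hkl]; rintro x hx; cases hx; exact h1
  · rw [getLast?_segment hkl]; rintro x hx; cases hx; exact h2
  · rw [length_segment]; omega

/-- Two disjoint segments, joined by two tight chords, one between their starts and one between
their ends. -/
theorem even_of_segments_reverse (hw : G.IsMinimalRim n w) {i j k l : ℕ} (hij : i ≤ j)
    (hjk : j < k) (hkl : k ≤ l) (hli : l < i + n) (hlen : j + l + 2 < n + i + k)
    (h1 : G.TightAdj (segments w i j k l) (w j) (w l))
    (h2 : G.TightAdj (segments w i j k l) (w k) (w i)) : Even (i + j + k + l) := by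
  have := hw.even_of_segment_append hij (Q := (segment w k l).reverse)
    (S := segments w i j k l) ?_ ?_ ?_ ?_
    (List.isChain_reverse.2 ((hw.isChain_segment _ _ _).imp fun _ _ h => h.symm)) ?_ ?_ ?_
  · rw [List.length_reverse, length_segment] at this
    rw [Nat.even_iff] at this ⊢
    omega
  · rintro z (hz | hz)
    · obtain ⟨t, h, h', rfl⟩ := mem_segment.1 hz
      exact ⟨t, Or.inl ⟨h, h'⟩, rfl⟩
    · obtain ⟨t, h, h', rfl⟩ := mem_segment.1 (List.mem_reverse.1 hz)
      exact ⟨t, Or.inr ⟨h, h'⟩, rfl⟩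
  · rw [← List.length_pos_iff, List.length_reverse, length_segment]; omega
  · exact List.nodup_reverse.2 (hw.nodup_segment (by omega))
  · intro z hz hz'
    obtain ⟨s, hs, hs', rfl⟩ := mem_segment.1 hz
    obtain ⟨t, ht, ht', h⟩ := mem_segment.1 (List.mem_reverse.1 hz')
    have := hw.eq_of_lt (i := i) (by omega) (by omega) hs (by omega) h
    omega
  · rw [List.head?_reverse, getLast?_segment hkl]; rintro x hx; cases hx; exact h1
  · rw [List.getLast?_reverse, head?_segment hkl]; rintro x hx; cases hx; exact h2
  · rw [List.length_reverse, length_segment]; omega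

/-- A tight chord cuts off a segment with an odd number of edges. -/
theorem odd_of_chord (hw : G.IsMinimalRim n w) {i l : ℕ} (hil : i < l) (hli : l + 1 < i + n)
    (h : G.TightAdj {z | ∃ t, i ≤ t ∧ t ≤ l ∧ w t = z} (w l) (w i)) : Odd (i + l) := by
  have := hw.even_of_segments (le_refl i) (Nat.lt_succ_self i) hil (by omega) (by omega)
    (hw.tightAdj_succ _ i) ⟨h.1, fun z hz => h.2 z ?_⟩
  · rw [Nat.even_iff] at this
    rw [Nat.odd_iff]
    omega
  · obtain ⟨t, ht, rfl⟩ := hz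
    exact ⟨t, by omega, by omega, rfl⟩

/-- A maximal clique of size two is an edge of the rim: otherwise it would split the rim into two
shorter tight cycles, one of them odd. -/
theorem eq_of_pair_mem (hw : G.IsMinimalRim n w) {i l : ℕ} (hil : i < l) (hli : l < i + n)
    (h : {w i, w l} ∈ G.maximalCliques) : l = i + 1 ∨ l + 1 = i + n := by
  by_contra hcon
  have hne : w i ≠ w l := fun h => hil.ne (hw.eq_of_lt le_rfl (by omega) hil.le hli h)
  have hadj : G.Adj (w i) (w l) :=
    adj_of_mem_maximalCliques h (Set.mem_insert _ _) (Set.mem_insert_of_mem _ rfl) hne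
  have ht : ∀ S, G.TightAdj S (w i) (w l) :=
    fun S => ⟨hadj, fun z _ => not_adj_of_pair_mem_maximalCliques hne h⟩
  have h1 := hw.odd_of_chord hil (by omega) (ht _).symm
  have h2 := hw.odd_of_chord hli (by omega) (by rw [hw.add_period]; exact ht _)
  have h3 := hw.odd
  rw [Nat.odd_iff] at h1 h2 h3
  omega

/-! ### Parity of the gaps of inscribed cliques -/

theorem tightAdj_of_mem (hw : G.IsMinimalRim n w) {A : Set V} (hA : A ∈ G.maximalCliques)
    {S : Set V} {u v : V} (hu : u ∈ A) (hv : v ∈ A) (huv : u ≠ v)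
    (hS : ∀ z ∈ S, z ∈ A → z = u ∨ z = v) : G.TightAdj S u v := by
  refine ⟨hA.1 hu hv huv, fun z hz h1 h2 => ?_⟩
  rcases hS z hz (hw.diamondFree.mem_of_adj_of_adj hA hu hv huv h1.symm h2.symm) with rfl | rfl
  exacts [h1.ne rfl, h2.ne rfl]

theorem finite (hw : G.IsMinimalRim n w) : Finite V := by
  refine Set.finite_univ_iff.1 ((Set.finite_lt_nat n).image w |>.subset fun z _ => ?_)
  obtain ⟨t, -, ht, rfl⟩ := hw.exists_index 0 z
  exact ⟨t, by simpa using ht, rfl⟩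

theorem two_le_ncard (hw : G.IsMinimalRim n w) {A : Set V} (hA : A ∈ G.maximalCliques) :
    2 ≤ A.ncard := by
  have := hw.finite
  have hnt : A.Nontrivial := by
    by_contra h
    rw [Set.not_nontrivial_iff] at h
    obtain ⟨i, hi⟩ : ∃ i, A ⊆ {w i} := by
      rcases h.eq_empty_or_singleton with rfl | ⟨x, rfl⟩
      · exact ⟨0, by simp⟩
      · obtain ⟨i, rfl⟩ := hw.surj x
        exact ⟨i, le_rfl⟩
    have hm : w (i + 1) ∈ A := mem_of_forall_adj hA fun x hx _ => by
      rw [hi hx]; exact (hw.adj i).symm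
    exact (hw.adj i).ne (hi hm).symm
  exact (Set.one_lt_ncard).2 hnt

theorem exists_third (hw : G.IsMinimalRim n w) {A : Set V} (hA : A ∈ G.inscribedCliques)
    (u v : V) : ∃ z ∈ A, z ≠ u ∧ z ≠ v := by
  have := hw.finite
  have h2 := hw.two_le_ncard hA.1
  have h3 := hA.2
  by_contra! h
  have hsub : A ⊆ {u, v} := fun z hz => by
    by_cases hzu : z = u
    · exact Or.inl hzu
    · exact Or.inr (h z hz hzu)
  have := Set.ncard_le_ncard hsub
  have := Set.ncard_insert_le u {v}
  have := Set.ncard_singleton v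
  omega

/-- A gap of an inscribed clique leaves out a vertex of the clique. -/
theorem gap_lt (hw : G.IsMinimalRim n w) {A : Set V} (hA : A ∈ G.inscribedCliques) {i l : ℕ}
    (hgap : ∀ t, i < t → t < l → w t ∉ A) :
    ∃ t, l < t ∧ t < i + n ∧ i < t ∧ w t ∈ A := by
  obtain ⟨z, hz, hzi, hzl⟩ := hw.exists_third hA (w i) (w l)
  obtain ⟨t, h1, h2, rfl⟩ := hw.exists_index i z
  have h3 : t ≠ i := fun h => hzi (by rw [h])
  have h4 : t ≠ l := fun h => hzl (by rw [h])
  have h5 : ¬ t < l := fun h => hgap t (by omega) h hz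
  exact ⟨t, by omega, h2, by omega, hz⟩

/-- Consecutive vertices of an inscribed clique are joined by an odd number of rim edges. -/
theorem odd_of_gap (hw : G.IsMinimalRim n w) {A : Set V} (hA : A ∈ G.inscribedCliques) {i l : ℕ}
    (hil : i < l) (hi : w i ∈ A) (hl : w l ∈ A) (hgap : ∀ t, i < t → t < l → w t ∉ A) :
    Odd (i + l) := by
  obtain ⟨t, h1, h2, -, -⟩ := hw.gap_lt hA hgap
  refine hw.odd_of_chord hil (by omega) (hw.tightAdj_of_mem hA.1 hl hi ?_ ?_)
  · exact fun h => hil.ne' (hw.eq_of_lt (i := i) hil.le (by omega) le_rfl (by omega) h)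
  · rintro _ ⟨s, hs, hs', rfl⟩ hz
    rcases hs.eq_or_lt with rfl | hs
    · exact Or.inr rfl
    rcases hs'.eq_or_lt with rfl | hs'
    · exact Or.inl rfl
    exact absurd hz (hgap s hs hs')

open Classical in
/-- The number of indices in `[p, q)` whose vertex lies in `A`. -/
noncomputable def count (w : ℕ → V) (A : Set V) (p q : ℕ) : ℕ :=
  ((Finset.Ico p q).filter fun t => w t ∈ A).card

theorem count_self (A : Set V) (p : ℕ) : count w A p p = 0 := by simp [count]

theorem count_add (A : Set V) {p q r : ℕ} (hpq : p ≤ q) (hqr : q ≤ r) :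
    count w A p q + count w A q r = count w A p r := by
  classical
  rw [count, count, count, ← Finset.Ico_union_Ico_eq_Ico hpq hqr, Finset.filter_union,
    Finset.card_union_of_disjoint]
  exact Finset.disjoint_filter_filter (Finset.Ico_disjoint_Ico_consecutive p q r)

theorem count_eq_zero {A : Set V} {p q : ℕ} (h : ∀ t, p ≤ t → t < q → w t ∉ A) :
    count w A p q = 0 := by
  classical
  rw [count, Finset.card_eq_zero, Finset.filter_eq_empty_iff]
  intro t ht
  rw [Finset.mem_Ico] at ht
  exact h t ht.1 ht.2

theorem count_succ {A : Set V} {p : ℕ} (h : w p ∈ A) : count w A p (p + 1) = 1 := by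
  classical
  simp [count, Finset.filter_singleton, h]

theorem count_of_gap {A : Set V} {p q : ℕ} (hpq : p < q) (h : w p ∈ A)
    (hgap : ∀ t, p < t → t < q → w t ∉ A) : count w A p q = 1 := by
  rw [← count_add A (Nat.le_succ p) hpq, count_succ h,
    count_eq_zero fun t h1 h2 => hgap t (by omega) h2]

theorem count_period (hw : G.IsMinimalRim n w) (A : Set V) (p : ℕ) :
    count w A p (p + n) = A.ncard := by
  classical
  have : A = w '' ((Finset.Ico p (p + n)).filter fun t => w t ∈ A : Finset ℕ) := by
    ext z
    simp only [Finset.coe_filter, Finset.mem_Ico, Set.mem_image, Set.mem_ofPred_eq]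
    constructor
    · intro hz
      obtain ⟨t, h1, h2, rfl⟩ := hw.exists_index p z
      exact ⟨t, ⟨⟨h1, h2⟩, hz⟩, rfl⟩
    · rintro ⟨t, ⟨-, h⟩, rfl⟩
      exact h
  conv_rhs => rw [this]
  rw [Set.InjOn.ncard_image, Set.ncard_coe_finset, count]
  intro s hs t ht hst
  simp only [Finset.coe_filter, Finset.mem_Ico, Set.mem_ofPred_eq] at hs ht
  exact hw.eq_of_lt hs.1.1 hs.1.2 ht.1.1 ht.1.2 hst

/-- As the gaps of `A` are odd, `q - p` has the parity of the number of vertices of `A` passed. -/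
theorem even_add_count (hw : G.IsMinimalRim n w) {A : Set V} (hA : A ∈ G.inscribedCliques)
    {p q : ℕ} (hpq : p ≤ q) (hp : w p ∈ A) (hq : w q ∈ A) : Even (p + q + count w A p q) := by
  induction q using Nat.strong_induction_on with
  | _ q ih =>
    rcases hpq.eq_or_lt with rfl | hpq
    · rw [count_self]; exact ⟨p, by omega⟩
    obtain ⟨x, h1, h2, h3, h4⟩ := Nat.exists_last_of_lt (p := fun t => w t ∈ A) hpq hp
    have h5 := ih x h2 h1 h3
    have h6 := hw.odd_of_gap hA h2 h3 hq h4
    have h7 := count_of_gap h2 h3 h4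
    have h8 := count_add (w := w) A h1 h2.le
    rw [Nat.even_iff] at h5 ⊢
    rw [Nat.odd_iff] at h6
    omega

theorem odd_ncard (hw : G.IsMinimalRim n w) {A : Set V} (hA : A ∈ G.inscribedCliques) :
    Odd A.ncard := by
  obtain ⟨z, hz, -⟩ := hw.exists_third hA (w 0) (w 0)
  obtain ⟨p, rfl⟩ := hw.surj z
  have h1 := hw.even_add_count hA (Nat.le_add_right p n) hz (by rwa [hw.add_period])
  have h2 := hw.odd
  rw [hw.count_period, Nat.even_iff] at h1
  rw [Nat.odd_iff] at h2 ⊢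
  omega

/-! ### Two inscribed cliques meet -/

/-- If `A` and `B` are disjoint, each gap of `A` that does not contain exactly one vertex of `B`
contains an even number of them: the segments from the ends of the gap to the first and to the last
of these vertices close up to a tight cycle. -/
theorem even_count_of_gap (hw : G.IsMinimalRim n w) {A B : Set V} (hA : A ∈ G.inscribedCliques)
    (hB : B ∈ G.inscribedCliques) (hAB : Disjoint A B) {i l : ℕ} (hil : i < l) (hi : w i ∈ A)
    (hl : w l ∈ A) (hgap : ∀ t, i < t → t < l → w t ∉ A) (hne : count w B i l ≠ 1) :
    Even (count w B i l) := by
  rw [Set.disjoint_left] at hAB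
  by_cases hex : ∃ t, i ≤ t ∧ t < l ∧ w t ∈ B
  swap
  · push Not at hex
    rw [count_eq_zero hex]; exact Even.zero
  obtain ⟨t, ht1, ht2, ht⟩ := hex
  have hit : i < t := lt_of_le_of_ne ht1 fun h => hAB hi (h ▸ ht)
  obtain ⟨j, hj1, hj2, hj, hj3⟩ := Nat.exists_first_of_lt (p := fun t => w t ∈ B) hit ht
  obtain ⟨k, hk1, hk2, hk, hk3⟩ := Nat.exists_last_of_lt (p := fun t => w t ∈ B) ht2 ht
  have hlo : count w B i j = 0 := count_eq_zero fun s h1 h2 hs => by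
    rcases h1.eq_or_lt with rfl | h1
    exacts [hAB hi hs, hj3 s h1 h2 hs]
  have hhi := count_of_gap hk2 hk hk3
  have hjk : j ≤ k := by omega
  have c1 := count_add (w := w) B (show i ≤ j by omega) hjk
  have c2 := count_add (w := w) B (show i ≤ k by omega) hk2.le
  have hjk' : j < k := by
    -- For `j = k` the gap would contain exactly one vertex of `B`.
    refine lt_of_le_of_ne hjk fun h => hne ?_
    rw [← h] at c2 hhi
    omega
  obtain ⟨s, hs1, hs2, -, -⟩ := hw.gap_lt hA hgap
  have h1 := hw.even_of_segments hj1.le hjk' hk2.le (by omega) (by omega)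
    (hw.tightAdj_of_mem hB.1 hj hk ?_ ?_) (hw.tightAdj_of_mem hA.1 hl hi ?_ ?_)
  · have h2 := hw.odd_of_gap hA hil hi hl hgap
    have h3 := hw.even_add_count hB hjk hj hk
    rw [Nat.even_iff] at h1 h3 ⊢
    rw [Nat.odd_iff] at h2
    omega
  · exact fun h => hjk'.ne (hw.eq_of_lt (i := i) (by omega) (by omega) (by omega) (by omega) h)
  · rintro _ ⟨x, hx, rfl⟩ hz
    rcases lt_trichotomy x j with h | rfl | h
    · rcases Nat.lt_or_ge i x with h' | h'
      · exact absurd hz (hj3 x h' h)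
      · exact absurd hz (hAB (show x = i by omega ▸ hi))
    · exact Or.inl rfl
    · rcases Nat.lt_or_ge k x with h' | h'
      · rcases Nat.lt_or_ge x l with h'' | h''
        · exact absurd hz (hk3 x h' h'')
        · exact absurd hz (hAB (show w x ∈ A by rwa [show x = l by omega]))
      · exact Or.inr (by rw [show x = k by omega])
  · exact fun h => hil.ne' (hw.eq_of_lt (i := i) (by omega) (by omega) (by omega) (by omega) h)
  · rintro _ ⟨x, hx, rfl⟩ hz
    rcases Nat.lt_or_ge i x with h | h
    · rcases Nat.lt_or_ge x l with h' | h'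
      · exact absurd hz (hgap x h h')
      · exact Or.inl (by rw [show x = l by omega])
    · exact Or.inr (by rw [show x = i by omega])

/-- The last index before `q` with a vertex in `A`, and the first index after it with a vertex in
`B`. -/
theorem exists_consecutive {A B : Set V} {p q : ℕ} (hpq : p < q) (hp : w p ∈ A) (hq : w q ∈ B) :
    ∃ x y, p ≤ x ∧ x < y ∧ y ≤ q ∧ w x ∈ A ∧ w y ∈ B ∧
      (∀ t, x < t → t ≤ y → w t ∈ A → t = q) ∧ (∀ t, x < t → t < y → w t ∉ B) := by
  obtain ⟨x, h1, h2, h3, h4⟩ := Nat.exists_last_of_lt (p := fun t => w t ∈ A) hpq hp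
  obtain ⟨y, h5, h6, h7, h8⟩ := Nat.exists_first_of_lt (p := fun t => w t ∈ B) h2 hq
  refine ⟨x, y, h1, h5, h6, h3, h7, fun t ht ht' hA => ?_, h8⟩
  by_contra hne
  exact h4 t ht (by omega) hA

/-- Disjoint inscribed cliques `A`, `B` do not exist. As `B` is odd, some gap of `A`, from `i` to
`l`, contains exactly one vertex of `B`, with index `j`, and one of the two segments from `j` to the
ends of this gap is even, the other odd. The rest of the rim contains a segment with one end in `A`
and the other in `B`, and it forms an odd tight cycle with one of these two. -/
theorem not_disjoint (hw : G.IsMinimalRim n w) {A B : Set V} (hA : A ∈ G.inscribedCliques)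
    (hB : B ∈ G.inscribedCliques) : ¬ Disjoint A B := by
  intro hAB'
  have hAB : ∀ {z}, z ∈ A → z ∉ B := fun h => Set.disjoint_left.1 hAB' h
  obtain ⟨i, j, l, hij, hjl, hi, hj, hl, hgap, hone⟩ : ∃ i j l, i < j ∧ j < l ∧ w i ∈ A ∧
      w j ∈ B ∧ w l ∈ A ∧ (∀ t, i < t → t < l → w t ∉ A) ∧
      ∀ t, i ≤ t → t ≤ l → w t ∈ B → t = j := by
    by_contra hcon
    obtain ⟨z, hz, -⟩ := hw.exists_third hA (w 0) (w 0)
    obtain ⟨p, rfl⟩ := hw.surj z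
    have key : ∀ q, p ≤ q → w q ∈ A → Even (count w B p q) := by
      intro q
      induction q using Nat.strong_induction_on with
      | _ q ih =>
        intro hpq hq
        rcases hpq.eq_or_lt with rfl | hpq
        · rw [count_self]; exact Even.zero
        obtain ⟨x, h1, h2, h3, h4⟩ := Nat.exists_last_of_lt (p := fun t => w t ∈ A) hpq hz
        rw [← count_add (w := w) B h1 h2.le]
        refine (ih x h2 h1 h3).add (hw.even_count_of_gap hA hB hAB' h2 h3 hq h4 fun hc => hcon ?_)
        classical
        obtain ⟨j, hj⟩ := Finset.card_eq_one.1 hc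
        have hm : ∀ t, x ≤ t → t < q → (w t ∈ B ↔ t = j) := by
          intro t h5 h6
          have := Finset.ext_iff.1 hj t
          simpa [h5, h6] using this
        have hjm : j ∈ (Finset.Ico x q).filter fun t => w t ∈ B := by rw [hj]; simp
        rw [Finset.mem_filter, Finset.mem_Ico] at hjm
        obtain ⟨⟨hj1, hj2⟩, hjB⟩ := hjm
        refine ⟨x, j, q, lt_of_le_of_ne hj1 fun h => hAB h3 (h ▸ hjB), hj2, h3, hjB, hq, h4, ?_⟩
        intro t h5 h6 h7
        rcases h6.eq_or_lt with rfl | h6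
        exacts [absurd h7 (hAB hq), (hm t h5 h6).1 h7]
    have h1 := key (p + n) (by omega) (by rwa [hw.add_period])
    rw [hw.count_period] at h1
    exact Nat.not_even_iff_odd.2 (hw.odd_ncard hB) h1
  obtain ⟨a, ha1, ha2, -, ha⟩ := hw.gap_lt hA hgap
  obtain ⟨b, hb1, hb2, hb⟩ : ∃ b, l < b ∧ b < i + n ∧ w b ∈ B := by
    obtain ⟨z, hz, hzj, -⟩ := hw.exists_third hB (w j) (w j)
    obtain ⟨t, h1, h2, rfl⟩ := hw.exists_index i z
    refine ⟨t, ?_, h2, hz⟩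
    by_contra h
    exact hzj (by rw [hone t h1 (by omega) hz])
  have hodd := hw.odd_of_gap hA (hij.trans hjl) hi hl hgap
  have hne : ∀ {s t}, i ≤ s → s < t → t < i + n → w s ≠ w t := fun h1 h2 h3 h4 =>
    h2.ne (hw.eq_of_lt h1 (by omega) (by omega) h3 h4)
  have hgapA : ∀ t, i ≤ t → t ≤ l → w t ∈ A → t = i ∨ t = l := by
    intro t h1 h2 h3
    by_contra h
    exact hgap t (by omega) (by omega) h3
  -- `x`, `y` bound a segment between `A` and `B` in the rest of the rim. With `[i, j]` and with
  -- `[j, l]` it gives two tight cycles whose parities add up to that of the odd gap `[i, l]`.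
  rcases lt_trichotomy a b with hab | rfl | hab
  · obtain ⟨x, y, hx1, hxy, hy1, hx, hy, hgA, hgB⟩ := exists_consecutive hab ha hb
    have hxA : ∀ t, x ≤ t → t ≤ y → w t ∈ A → t = x := by
      intro t h1 h2 h3
      by_contra h
      exact hAB h3 ((hgA t (by omega) h2 h3) ▸ hb)
    have hyB : ∀ t, x ≤ t → t ≤ y → w t ∈ B → t = y := by
      intro t h1 h2 h3
      by_contra h
      rcases h1.eq_or_lt with rfl | h1
      exacts [hAB hx h3, hgB t h1 (by omega) h3]
    have e1 := hw.even_of_segments_reverse hij.le (show j < x by omega) hxy.le (by omega)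
      (by omega)
      (hw.tightAdj_of_mem hB.1 hj hy (hne (by omega) (by omega) (by omega)) (by
        rintro _ ⟨t, h | h, rfl⟩ hz
        · exact Or.inl (by rw [hone t h.1 (by omega) hz])
        · exact Or.inr (by rw [hyB t h.1 h.2 hz])))
      (hw.tightAdj_of_mem hA.1 hx hi (hne (by omega) (by omega) (by omega)).symm (by
        rintro _ ⟨t, h | h, rfl⟩ hz
        · exact Or.inr (by rw [show t = i by have := hgapA t h.1 (by omega) hz; omega])
        · exact Or.inl (by rw [hxA t h.1 h.2 hz])))
    have e2 := hw.even_of_segments hjl.le (show l < x by omega) hxy.le (by omega) (by omega)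
      (hw.tightAdj_of_mem hA.1 hl hx (hne (by omega) (by omega) (by omega)) (by
        rintro _ ⟨t, h | h, rfl⟩ hz
        · exact Or.inl (by
            rw [show t = l by have := hgapA t (by omega) (by omega) hz; omega])
        · exact Or.inr (by rw [hxA t h.1 h.2 hz])))
      (hw.tightAdj_of_mem hB.1 hy hj (hne (by omega) (by omega) (by omega)).symm (by
        rintro _ ⟨t, h | h, rfl⟩ hz
        · exact Or.inr (by rw [hone t (by omega) (by omega) hz])
        · exact Or.inl (by rw [hyB t h.1 h.2 hz])))
    rw [Nat.even_iff] at e1 e2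
    rw [Nat.odd_iff] at hodd
    omega
  · exact hAB ha hb
  · obtain ⟨x, y, hx1, hxy, hy1, hx, hy, hgB, hgA⟩ := exists_consecutive hab hb ha
    have hxB : ∀ t, x ≤ t → t ≤ y → w t ∈ B → t = x := by
      intro t h1 h2 h3
      by_contra h
      exact hAB ((hgB t (by omega) h2 h3) ▸ ha) h3
    have hyA : ∀ t, x ≤ t → t ≤ y → w t ∈ A → t = y := by
      intro t h1 h2 h3
      by_contra h
      rcases h1.eq_or_lt with rfl | h1
      exacts [hAB h3 hx, hgA t h1 (by omega) h3]
    have e1 := hw.even_of_segments hij.le (show j < x by omega) hxy.le (by omega) (by omega)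
      (hw.tightAdj_of_mem hB.1 hj hx (hne (by omega) (by omega) (by omega)) (by
        rintro _ ⟨t, h | h, rfl⟩ hz
        · exact Or.inl (by rw [hone t h.1 (by omega) hz])
        · exact Or.inr (by rw [hxB t h.1 h.2 hz])))
      (hw.tightAdj_of_mem hA.1 hy hi (hne (by omega) (by omega) (by omega)).symm (by
        rintro _ ⟨t, h | h, rfl⟩ hz
        · exact Or.inr (by rw [show t = i by have := hgapA t h.1 (by omega) hz; omega])
        · exact Or.inl (by rw [hyA t h.1 h.2 hz])))
    have e2 := hw.even_of_segments_reverse hjl.le (show l < x by omega) hxy.le (by omega)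
      (by omega)
      (hw.tightAdj_of_mem hA.1 hl hy (hne (by omega) (by omega) (by omega)) (by
        rintro _ ⟨t, h | h, rfl⟩ hz
        · exact Or.inl (by
            rw [show t = l by have := hgapA t (by omega) (by omega) hz; omega])
        · exact Or.inr (by rw [hyA t h.1 h.2 hz])))
      (hw.tightAdj_of_mem hB.1 hx hj (hne (by omega) (by omega) (by omega)).symm (by
        rintro _ ⟨t, h | h, rfl⟩ hz
        · exact Or.inr (by rw [hone t (by omega) (by omega) hz])
        · exact Or.inl (by rw [hxB t h.1 h.2 hz])))
    rw [Nat.even_iff] at e1 e2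
    rw [Nat.odd_iff] at hodd
    omega

/-- A segment of the rim between two inscribed cliques that meet in a vertex `ξ` off the segment
has an even number of edges: together with `ξ` it forms a tight cycle. -/
theorem even_of_segment_between (hw : G.IsMinimalRim n w) {A B : Set V}
    (hA : A ∈ G.inscribedCliques) (hB : B ∈ G.inscribedCliques) {ξ : V} (hξ : A ∩ B = {ξ})
    {i j : ℕ} (hij : i < j) (hi : w i ∈ A) (hj : w j ∈ B) (hiξ : w i ≠ ξ)
    (hjξ : w j ≠ ξ) (hgA : ∀ t, i < t → t < j → w t ∉ A) (hgB : ∀ t, i < t → t < j → w t ∉ B) :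
    Even (i + j) := by
  have hmem : ∀ {z}, z ∈ A → z ∈ B → z = ξ := fun h1 h2 => by
    have : _ ∈ A ∩ B := ⟨h1, h2⟩
    rwa [hξ] at this
  have hξm : ξ ∈ A ∩ B := by rw [hξ]; rfl
  obtain ⟨k, hk1, hk2, rfl⟩ := hw.exists_index i ξ
  have hik : i ≠ k := fun h => hiξ (by rw [h])
  have hjk' : j ≠ k := fun h => hjξ (by rw [h])
  have hjk : j < k := by
    by_contra h
    exact hgA k (by omega) (by omega) hξm.1
  obtain ⟨z, hz, hzi, hzk⟩ := hw.exists_third hA (w i) (w k)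
  obtain ⟨s, hs1, hs2, rfl⟩ := hw.exists_index i z
  have hsi : s ≠ i := fun h => hzi (by rw [h])
  have hsk : s ≠ k := fun h => hzk (by rw [h])
  have hsj' : s ≠ j := fun h => hjξ (hmem (h ▸ hz) hj)
  have hsj : j < s := by
    by_contra h
    exact hgA s (by omega) (by omega) hz
  have e := hw.even_of_segments hij.le hjk le_rfl hk2 (by omega)
    (hw.tightAdj_of_mem hB.1 hj hξm.2 hjξ (by
      rintro _ ⟨t, h | h, rfl⟩ hz
      · left
        by_contra hne
        have : t ≠ j := fun h => hne (by rw [h])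
        have : t ≠ i := fun h => hiξ (hmem hi (h ▸ hz))
        exact hgB t (by omega) (by omega) hz
      · exact Or.inr (by rw [show t = k by omega])))
    (hw.tightAdj_of_mem hA.1 hξm.1 hi hiξ.symm (by
      rintro _ ⟨t, h | h, rfl⟩ hz
      · right
        by_contra hne
        have : t ≠ i := fun h => hne (by rw [h])
        have : t ≠ j := fun h => hjξ (hmem (h ▸ hz) hj)
        exact hgA t (by omega) (by omega) hz
      · exact Or.inl (by rw [show t = k by omega])))
  rw [Nat.even_iff] at e ⊢
  omega

/-! ### Removing inscribed cliques -/

theorem pair_mem (hw : G.IsMinimalRim n w) (i : ℕ) : {w i, w (i + 1)} ∈ G.maximalCliques :=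
  pair_mem_maximalCliques (hw.adj i) (hw.not_adj i)

theorem removeCliques_adj_succ (hw : G.IsMinimalRim n w) {R : Set (Set V)}
    (hR : R ⊆ G.inscribedCliques) (i : ℕ) : (G.removeCliques R).Adj (w i) (w (i + 1)) := by
  refine removeCliques_adj.2 ⟨hw.adj i, fun K hK h1 h2 => (hR hK).2 ?_⟩
  rw [hw.diamondFree.eq_of_mem (hR hK).1 (hw.pair_mem i) (hw.adj i).ne h1 h2
    (Set.mem_insert _ _) (Set.mem_insert_of_mem _ rfl)]
  exact Set.ncard_pair (hw.adj i).ne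

/-- Removing inscribed cliques creates no new maximal clique: cliques of `G` share no edge, and
each vertex keeps its rim edges. -/
theorem maximalCliques_removeCliques_subset (hw : G.IsMinimalRim n w) {R : Set (Set V)}
    (hR : R ⊆ G.inscribedCliques) : (G.removeCliques R).maximalCliques ⊆ G.maximalCliques := by
  have := hw.finite
  intro A hA
  obtain ⟨K, hK, hAK⟩ := exists_mem_maximalCliques (G := G) (K := A)
    fun x hx y hy hxy => (removeCliques_adj.1 (hA.1 hx hy hxy)).1
  have hnt : A.Nontrivial := by
    by_contra h
    rw [Set.not_nontrivial_iff] at h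
    obtain ⟨i, hi⟩ : ∃ i, A ⊆ {w i} := by
      rcases h.eq_empty_or_singleton with rfl | ⟨x, rfl⟩
      · exact ⟨0, by simp⟩
      · obtain ⟨i, rfl⟩ := hw.surj x
        exact ⟨i, le_rfl⟩
    have hm : w (i + 1) ∈ A := mem_of_forall_adj hA fun x hx _ => by
      rw [hi hx]; exact (hw.removeCliques_adj_succ hR i).symm
    exact (hw.adj i).ne (hi hm).symm
  obtain ⟨u, hu, v, hv, huv⟩ := hnt
  have hKR : K ∉ R := fun h =>
    (removeCliques_adj.1 (hA.1 hu hv huv)).2 K h (hAK hu) (hAK hv)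
  have hKA : K ⊆ A := hA.2 (y := K) (fun x hx y hy hxy => removeCliques_adj.2
    ⟨hK.1 hx hy hxy, fun L hL hxL hyL => hKR
      (hw.diamondFree.eq_of_mem hK (hR hL).1 hxy hx hy hxL hyL ▸ hL)⟩) hAK
  rwa [hAK.antisymm hKA]

theorem inscribedCliques_removeCliques_subset (hw : G.IsMinimalRim n w) {R : Set (Set V)}
    (hR : R ⊆ G.inscribedCliques) :
    (G.removeCliques R).inscribedCliques ⊆ G.inscribedCliques :=
  fun _ hA => ⟨hw.maximalCliques_removeCliques_subset hR hA.1, hA.2⟩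

theorem rim_removeCliques_le (hw : G.IsMinimalRim n w) {R : Set (Set V)}
    (hR : R ⊆ G.inscribedCliques) : (G.removeCliques R).rim ≤ G.rim :=
  fun _ _ h => ⟨h.1, hw.maximalCliques_removeCliques_subset hR h.2⟩

/-! ### Paths of the rim -/

theorem eq_or_eq_of_rim_adj (hw : G.IsMinimalRim n w) {i : ℕ} {y : V}
    (h : G.rim.Adj (w (i + 1)) y) : y = w i ∨ y = w (i + 2) := by
  obtain ⟨t, h1, h2, rfl⟩ := hw.exists_index (i + 1) y
  have hne : t ≠ i + 1 := fun he => h.1 (by rw [he])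
  rcases hw.eq_of_pair_mem (by omega) h2 h.2 with rfl | h3
  · exact Or.inr rfl
  · left
    rw [show t = i + n by omega, hw.add_period]

/-- A path that starts along the sequence `f` follows it, if each inner vertex of `f` is adjacent to
no vertices other than its predecessor and its successor. -/
theorem _root_.SimpleGraph.Walk.IsPath.getVert_eq_of_forall_adj {H : SimpleGraph V} {u v : V}
    {P : H.Walk u v} (hP : P.IsPath) {f : ℕ → V}
    (hf : ∀ t, t + 1 < P.length → ∀ y, H.Adj (f (t + 1)) y → y = f t ∨ y = f (t + 2))
    (h0 : P.getVert 0 = f 0) (h1 : P.getVert 1 = f 1) :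
    ∀ t, t + 1 ≤ P.length → P.getVert t = f t ∧ P.getVert (t + 1) = f (t + 1) := by
  intro t
  induction t with
  | zero => exact fun _ => ⟨h0, h1⟩
  | succ t ih =>
    intro ht
    obtain ⟨h2, h3⟩ := ih (by omega)
    refine ⟨h3, ?_⟩
    have hadj := P.adj_getVert_succ (i := t + 1) (by omega)
    rw [h3] at hadj
    refine (hf t (by omega) _ hadj).resolve_left fun h => ?_
    have := hP.getVert_injOn (by rw [Set.mem_ofPred_eq]; omega)
      (by rw [Set.mem_ofPred_eq]; omega) (h.trans h2.symm)
    omega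

/-- The vertices of a path along the rim form a segment of the rim. -/
theorem exists_segment_of_isPath (hw : G.IsMinimalRim n w) {H : SimpleGraph V} (hH : H ≤ G.rim)
    {u v : V} {P : H.Walk u v} (hP : P.IsPath) (huv : u ≠ v) :
    ∃ i j, i < j ∧ P.support.length = j - i + 1 ∧ (w i = u ∧ w j = v ∨ w i = v ∧ w j = u) ∧
      ∀ t, i < t → t < j → w t ∈ P.support ∧ w t ≠ u ∧ w t ≠ v := by
  obtain ⟨m, hm, -, hmu⟩ := hw.exists_index (P.length + 1) u
  have hlen : 0 < P.length := by
    rw [Nat.pos_iff_ne_zero]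
    exact fun h => huv (Walk.eq_of_length_eq_zero h)
  have hne : ∀ s, 0 < s → s < P.length →
      P.getVert s ∈ P.support ∧ P.getVert s ≠ u ∧ P.getVert s ≠ v := by
    intro s h1 h2
    refine ⟨P.getVert_mem_support s, fun h => ?_, fun h => ?_⟩
    · have := hP.getVert_injOn (by rw [Set.mem_ofPred_eq]; omega)
        (by rw [Set.mem_ofPred_eq]; omega) (h.trans P.getVert_zero.symm)
      omega
    · have := hP.getVert_injOn (by rw [Set.mem_ofPred_eq]; omega)
        (by rw [Set.mem_ofPred_eq]) (h.trans P.getVert_length.symm)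
      omega
  have hadj := P.adj_getVert_succ hlen
  have hw0 : P.getVert 0 = w (m - 1 + 1) := by
    rw [P.getVert_zero, ← hmu, show m - 1 + 1 = m by omega]
  rw [hw0] at hadj
  rcases hw.eq_or_eq_of_rim_adj (hH hadj) with h1 | h1
  -- The path runs along the rim, either backwards or forwards.
  · have key := hP.getVert_eq_of_forall_adj (f := fun t => w (m - t)) ?_ (by simpa using hmu.symm)
      h1
    · refine ⟨m - P.length, m, by omega, by rw [Walk.length_support]; omega, Or.inr ⟨?_, hmu⟩, ?_⟩
      · have := (key (P.length - 1) (by omega)).2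
        rw [show P.length - 1 + 1 = P.length by omega, P.getVert_length] at this
        exact this.symm
      · intro t h2 h3
        have h4 := hne (m - t) (by omega) (by omega)
        rwa [(key (m - t) (by omega)).1, show m - (m - t) = t by omega] at h4
    · intro t ht y hy
      rw [show m - (t + 1) = m - (t + 2) + 1 by omega] at hy
      rw [show m - t = m - (t + 2) + 2 by omega]
      exact (hw.eq_or_eq_of_rim_adj (hH hy)).symm
  · have key := hP.getVert_eq_of_forall_adj (f := fun t => w (m + t)) ?_ (by simpa using hmu.symm)
      (by rw [h1]; congr 1; omega)
    · refine ⟨m, m + P.length, by omega, by rw [Walk.length_support]; omega,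
        Or.inl ⟨hmu, ?_⟩, ?_⟩
      · have := (key (P.length - 1) (by omega)).2
        rw [show P.length - 1 + 1 = P.length by omega, P.getVert_length] at this
        exact this.symm
      · intro t h2 h3
        have h4 := hne (t - m) (by omega) (by omega)
        rwa [(key (t - m) (by omega)).1, show m + (t - m) = t by omega] at h4
    · exact fun t ht y hy => hw.eq_or_eq_of_rim_adj (hH hy)

/-! ### The N-conditions -/

theorem not_mem_succ_of_mem (hw : G.IsMinimalRim n w) {A : Set V} (hA : A ∈ G.inscribedCliques)
    {i : ℕ} (hi : w i ∈ A) : w (i + 1) ∉ A := by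
  intro h
  apply hA.2
  rw [hw.diamondFree.eq_of_mem hA.1 (hw.pair_mem i) (hw.adj i).ne hi h
    (Set.mem_insert _ _) (Set.mem_insert_of_mem _ rfl)]
  exact Set.ncard_pair (hw.adj i).ne

/-- Any two inscribed cliques meet in a single vertex, and by the Helly property it is the same one
for all pairs. -/
theorem exists_common_vertex (hw : G.IsMinimalRim n w) :
    ∃ ξ : V, ∀ A ∈ G.inscribedCliques, ∀ B ∈ G.inscribedCliques, A ≠ B → A ∩ B = {ξ} := by
  have := hw.finite
  by_cases h : ∃ A ∈ G.inscribedCliques, ∃ B ∈ G.inscribedCliques, A ≠ B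
  swap
  · push Not at h
    exact ⟨w 0, fun A hA B hB hAB => absurd (h A hA B hB) hAB⟩
  obtain ⟨A, hA, B, hB, hAB⟩ := h
  have hint : ∀ {A B}, A ∈ G.inscribedCliques → B ∈ G.inscribedCliques → (A ∩ B).Nonempty :=
    fun hA hB => Set.not_disjoint_iff_nonempty_inter.1 (hw.not_disjoint hA hB)
  obtain ⟨x, hxA, hxB⟩ := hint hA hB
  have hx : ∀ C ∈ G.inscribedCliques, x ∈ C := fun C hC =>
    hw.diamondFree.mem_of_inter hA.1 hB.1 hC.1 hAB hxA hxB (hint hA hC) (hint hB hC)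
  refine ⟨x, fun C hC D hD hCD => Set.eq_singleton_iff_unique_mem.2 ⟨⟨hx C hC, hx D hD⟩, ?_⟩⟩
  rintro y ⟨hyC, hyD⟩
  by_contra hyx
  exact hCD (hw.diamondFree.eq_of_mem hC.1 hD.1 hyx hyC (hx C hC) hyD (hx D hD))

/-- An `A`-path, in `G` or in a sub-multisun `H`, is a gap of the clique `A`. -/
theorem even_of_isCliquePath (hw : G.IsMinimalRim n w) {H : SimpleGraph V}
    (hrim : H.rim ≤ G.rim) (hsub : H.inscribedCliques ⊆ G.inscribedCliques) {A : Set V}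
    (hA : A ∈ H.inscribedCliques) {u v : V} {P : H.rim.Walk u v} (hP : H.IsCliquePath A A P) :
    Even P.support.length ∧ 4 ≤ P.support.length := by
  obtain ⟨i, j, hij, hlen, hends, hin⟩ := hw.exists_segment_of_isPath hrim hP.isPath hP.ne
  have hgap : ∀ t, i < t → t < j → w t ∉ A := fun t h1 h2 =>
    hP.inner _ (hin t h1 h2).1 (hin t h1 h2).2.1 (hin t h1 h2).2.2 A hA
  have hi : w i ∈ A := by
    rcases hends with ⟨h, -⟩ | ⟨h, -⟩
    exacts [h ▸ hP.left_mem, h ▸ hP.right_mem]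
  have hj : w j ∈ A := by
    rcases hends with ⟨-, h⟩ | ⟨-, h⟩
    exacts [h ▸ hP.right_mem, h ▸ hP.left_mem]
  have hodd := hw.odd_of_gap (hsub hA) hij hi hj hgap
  have hne : j ≠ i + 1 := fun h => hw.not_mem_succ_of_mem (hsub hA) hi (h ▸ hj)
  rw [Nat.odd_iff] at hodd
  rw [hlen, Nat.even_iff]
  omega

/-- The same vertex `ξ` serves for `G` and all its sub-multisuns. As `ξ` lies in every inscribed
clique if there are at least two, the fourth condition is a case of the first. -/
theorem nConditions_removeCliques (hw : G.IsMinimalRim n w) {R : Set (Set V)}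
    (hR : R ⊆ G.inscribedCliques) : (G.removeCliques R).NConditions := by
  obtain ⟨ξ, hξ⟩ := hw.exists_common_vertex
  have hrim := hw.rim_removeCliques_le hR
  have hsub := hw.inscribedCliques_removeCliques_subset hR
  refine ⟨ξ, ?_, fun A hA => hw.odd_ncard (hsub hA), fun A hA B hB => hξ A (hsub hA) B (hsub hB),
    ?_, ?_⟩
  · exact fun A hA u v P hP => hw.even_of_isCliquePath hrim hsub hA hP
  · intro A hA B hB u P hP
    have hmem : ξ ∈ A := by
      by_cases hAB : A = B
      · exact hAB ▸ hP.right_mem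
      · have : ξ ∈ A ∩ B := by rw [hξ A (hsub hA) B (hsub hB) hAB]; rfl
        exact this.1
    exact (hw.even_of_isCliquePath hrim hsub hA
      ⟨hP.isPath, hP.ne, hP.left_mem, hmem, hP.inner⟩).1
  · intro A hA B hB hAB u v P hP hu hv
    obtain ⟨i, j, hij, hlen, hends, hin⟩ := hw.exists_segment_of_isPath hrim hP.isPath hP.ne
    have hgap : ∀ K ∈ (G.removeCliques R).inscribedCliques, ∀ t, i < t → t < j → w t ∉ K :=
      fun K hK t h1 h2 =>
        hP.inner _ (hin t h1 h2).1 (hin t h1 h2).2.1 (hin t h1 h2).2.2 K hK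
    have heven : Even (i + j) := by
      rcases hends with ⟨rfl, rfl⟩ | ⟨rfl, rfl⟩
      · exact hw.even_of_segment_between (hsub hA) (hsub hB) (hξ A (hsub hA) B (hsub hB) hAB) hij
          hP.left_mem hP.right_mem hu hv (hgap A hA) (hgap B hB)
      · exact hw.even_of_segment_between (hsub hB) (hsub hA)
          (hξ B (hsub hB) A (hsub hA) hAB.symm) hij
          hP.right_mem hP.left_mem hv hu (hgap B hB) (hgap A hA)
    rw [Nat.even_iff] at heven
    rw [hlen, Nat.odd_iff]
    omega

/-! ### Minimal odd tight cycles span sunoids -/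

theorem rim_adj_iff (hw : G.IsMinimalRim n w) {i j : ℕ} (hij : i < j) (hj : j < n) :
    G.rim.Adj (w i) (w j) ↔ j = i + 1 ∨ j + 1 = i + n := by
  constructor
  · exact fun h => hw.eq_of_pair_mem hij (by omega) h.2
  · rintro (rfl | h)
    · exact ⟨(hw.adj i).ne, hw.pair_mem i⟩
    · have : w i = w (j + 1) := by rw [h, hw.add_period]
      rw [this]
      have hadj : G.rim.Adj (w j) (w (j + 1)) := ⟨(hw.adj j).ne, hw.pair_mem j⟩
      exact hadj.symm

theorem bijective (hw : G.IsMinimalRim n w) : Function.Bijective fun i : Fin n => w i := by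
  constructor
  · intro i j h
    exact Fin.ext (hw.eq_of_lt (Nat.zero_le _) (by omega) (Nat.zero_le _) (by omega) h)
  · intro z
    obtain ⟨t, -, ht, rfl⟩ := hw.exists_index 0 z
    exact ⟨⟨t, by omega⟩, rfl⟩

theorem card_eq (hw : G.IsMinimalRim n w) : Nat.card V = n := by
  rw [← Nat.card_congr (Equiv.ofBijective _ hw.bijective), Nat.card_fin]

theorem nonempty_iso_rim (hw : G.IsMinimalRim n w) : Nonempty (cycleGraph n ≃g G.rim) := by
  refine ⟨⟨Equiv.ofBijective _ hw.bijective, ?_⟩⟩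
  intro i j
  rw [cycleGraph_adj']
  simp only [Equiv.ofBijective_apply]
  have key : ∀ i j : Fin n, i < j →
      (G.rim.Adj (w i) (w j) ↔ (i - j).val = 1 ∨ (j - i).val = 1) := by
    intro i j hij
    have hij' : i.val < j.val := hij
    rw [hw.rim_adj_iff hij j.2, Fin.sub_def, Fin.sub_def]
    simp only
    rw [Nat.mod_eq_of_lt (by omega), show n - i.val + j.val = j.val - i.val + n by omega,
      Nat.add_mod_right, Nat.mod_eq_of_lt (by omega)]
    omega
  rcases lt_trichotomy i j with h | rfl | h
  · exact key i j h
  · have h3 := hw.three_le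
    simp [Fin.sub_def]
  · rw [adj_comm, key j i h, or_comm]

theorem isMultisun (hw : G.IsMinimalRim n w) : G.IsMultisun where
  diamondFree := hw.diamondFree
  odd_card := hw.card_eq ▸ hw.odd
  three_le_card := hw.card_eq ▸ hw.three_le
  rim_cycle := hw.card_eq.symm ▸ hw.nonempty_iso_rim
  nonconsecutive := by
    intro K hK u hu v hv h
    apply hK.2
    rw [hw.diamondFree.eq_of_mem hK.1 h.2 h.1 hu hv (Set.mem_insert _ _)
      (Set.mem_insert_of_mem _ rfl)]
    exact Set.ncard_pair h.1

theorem isSunoid (hw : G.IsMinimalRim n w) : G.IsSunoid := by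
  refine ⟨hw.isMultisun, ?_, ?_⟩
  · have := hw.nConditions_removeCliques (Set.empty_subset _)
    rwa [removeCliques_empty] at this
  · rintro H ⟨R, hR, rfl⟩
    exact hw.nConditions_removeCliques hR.subset

end IsMinimalRim

theorem IsTightCycle.tightAdj_getElem_mod {V : Type*} {G : SimpleGraph V} {l : List V}
    (hl : G.IsTightCycle l) (h0 : 0 < l.length) (i : ℕ) :
    G.TightAdj {z | z ∈ l} (l[i % l.length]'(Nat.mod_lt _ h0))
      (l[(i + 1) % l.length]'(Nat.mod_lt _ h0)) := by
  have hi := Nat.mod_lt i h0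
  have hmod := Nat.mod_add_mod i l.length 1
  rcases Nat.lt_or_ge (i % l.length + 1) l.length with h | h
  · have := (List.isChain_iff_getElem.1 hl.chain) (i % l.length) h
    rw [Nat.mod_eq_of_lt h] at hmod
    rw [getElem_congr_idx hmod.symm]
    exact this
  · rw [show i % l.length + 1 = l.length by omega, Nat.mod_self] at hmod
    rw [getElem_congr_idx hmod.symm]
    refine hl.closed _ ?_ _ ?_
    · rw [List.getLast?_eq_getElem?, Option.mem_def, List.getElem?_eq_some_iff]
      exact ⟨by omega, getElem_congr_idx (by omega)⟩
    · rw [List.head?_eq_getElem?, Option.mem_def, List.getElem?_eq_some_iff]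
      exact ⟨h0, rfl⟩

/-- The vertices of a shortest odd tight cycle induce a sunoid. An odd hole is the case without
inscribed cliques. -/
theorem IsDiamondFree.exists_isSunoid {V : Type*} {G : SimpleGraph V} (hG : G.IsDiamondFree)
    (h : ¬ G.IsBalanced) : ∃ S : Set V, (G.induce S).IsSunoid := by
  classical
  have hex : ∃ n, ∃ l : List V, G.IsTightCycle l ∧ Odd l.length ∧ l.length = n := by
    obtain ⟨l, hl, ho⟩ := hG.exists_isTightCycle_of_not_isBalanced h
    exact ⟨_, l, hl, ho, rfl⟩
  obtain ⟨l, hl, ho, hn⟩ := Nat.find_spec hex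
  have hmin : ∀ l', G.IsTightCycle l' → Odd l'.length → l.length ≤ l'.length :=
    fun l' h1 h2 => hn ▸ Nat.find_min' hex ⟨l', h1, h2, rfl⟩
  have h3 := hl.three_le ho
  have h0 : 0 < l.length := by omega
  let w : ℕ → {z | z ∈ l} := fun i => ⟨l[i % l.length]'(Nat.mod_lt _ h0), List.getElem_mem _⟩
  have hw : (G.induce {z | z ∈ l}).IsMinimalRim l.length w :=
    { diamondFree := hG.induce _
      odd := ho
      three_le := h3
      eq_iff := fun i j => by
        rw [Subtype.ext_iff]
        exact hl.nodup.getElem_inj_iff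
      surj := by
        rintro ⟨z, hz⟩
        obtain ⟨i, hi, rfl⟩ := List.getElem_of_mem hz
        exact ⟨i, Subtype.ext (getElem_congr_idx (Nat.mod_eq_of_lt hi))⟩
      adj := fun i => (hl.tightAdj_getElem_mod h0 i).1
      not_adj := fun i z => (hl.tightAdj_getElem_mod h0 i).2 z z.2
      minimal := fun l' h1 h2 => by
        have := hmin _ h1.map_induce (by rwa [List.length_map])
        rwa [List.length_map] at this }
  exact ⟨_, hw.isSunoid⟩

/-! ### Odd holes and multisuns are unbalanced -/

/-- An odd cycle none of whose edges lies in a triangle of the subgraph induced by its vertices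
makes `G` unbalanced: maximal cliques that contain its edges give the rows of an odd submatrix. -/
theorem not_isBalanced_of_cycle {V : Type*} [Finite V] {G : SimpleGraph V} {n : ℕ} [NeZero n]
    (hn : 3 ≤ n) (ho : Odd n) (f : Fin n → V) (hf : Function.Injective f)
    (hadj : ∀ i, G.Adj (f i) (f (i + 1)))
    (hnot : ∀ i j, G.Adj (f i) (f j) → ¬ G.Adj (f (i + 1)) (f j)) : ¬ G.IsBalanced := by
  classical
  choose K hK hK1 hK2 using fun i => exists_mem_maximalCliques_of_adj (hadj i)
  have hone : ((1 : Fin n) : ℕ) = 1 := by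
    rw [Fin.val_one', Nat.mod_eq_of_lt (by omega)]
  have h10 : (1 : Fin n) ≠ 0 := fun h => by
    have := congrArg Fin.val h
    rw [hone] at this
    simp at this
  have h20 : (1 + 1 : Fin n) ≠ 0 := fun h => by
    have := congrArg Fin.val h
    rw [Fin.val_add, hone, Nat.mod_eq_of_lt (by omega)] at this
    simp at this
  have hm : ∀ i j, f j ∈ K i ↔ j = i ∨ j = i + 1 := by
    intro i j
    constructor
    · intro hj
      by_contra! hcon
      exact hnot i j ((hK i).1 (hK1 i) hj fun h => hcon.1 (hf h).symm)
        ((hK i).1 (hK2 i) hj fun h => hcon.2 (hf h).symm)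
    · rintro (rfl | rfl)
      exacts [hK1 _, hK2 _]
  have hinj : Function.Injective fun i => (⟨K i, hK i⟩ : G.maximalCliques) := by
    intro i j hij
    have hij : K i = K j := congrArg Subtype.val hij
    have h1 := (hm j i).1 (hij ▸ hK1 i)
    have h2 := (hm i j).1 (hij ▸ hK1 j)
    rcases h1 with h1 | h1
    · exact h1
    · rcases h2 with h2 | h2
      · exact h2.symm
      · rw [h1, add_assoc] at h2
        exact absurd (left_eq_add.1 h2) h20
  rw [IsBalanced, Matrix.IsBalanced, not_not]
  refine ⟨n, ⟨_, hinj⟩, ⟨f, hf⟩, ho, ?_, ?_⟩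
  · intro i
    rw [Finset.card_eq_two]
    refine ⟨i, i + 1, fun h => h10 (left_eq_add.1 h), ?_⟩
    ext j
    simp [cliqueMatrix, hm]
    tauto
  · intro j
    rw [Finset.card_eq_two]
    refine ⟨j, j - 1, fun h => h10 (sub_eq_self.1 h.symm), ?_⟩
    ext i
    simp [cliqueMatrix, hm, eq_sub_iff_add_eq, eq_comm]
    tauto

theorem ContainsOddHole.not_isBalanced {V : Type*} [Finite V] {G : SimpleGraph V}
    (h : G.ContainsOddHole) : ¬ G.IsBalanced := by
  obtain ⟨n, hn, ho, ⟨e⟩⟩ := h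
  have : NeZero n := ⟨by omega⟩
  refine not_isBalanced_of_cycle (by omega) ho e e.injective ?_ ?_
  · intro i
    rw [e.map_adj_iff, cycleGraph_adj']
    right
    rw [add_sub_cancel_left, Fin.val_one', Nat.mod_eq_of_lt (by omega)]
  · intro i j
    rw [e.map_adj_iff, e.map_adj_iff, cycleGraph_adj', cycleGraph_adj']
    have h1 := i.2
    have h2 := j.2
    have h3 : (i + 1).val = if i.val + 1 = n then 0 else i.val + 1 := by
      rw [Fin.val_add, Fin.val_one', Nat.mod_eq_of_lt (show 1 < n by omega)]
      split_ifs with h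
      · rw [h, Nat.mod_self]
      · exact Nat.mod_eq_of_lt (by omega)
    have h4 : ∀ a b : Fin n, (a - b).val = if b.val ≤ a.val then a.val - b.val
        else n - b.val + a.val := by
      intro a b
      rw [Fin.sub_def]
      simp only
      split_ifs with h
      · rw [show n - b.val + a.val = a.val - b.val + n by omega, Nat.add_mod_right,
          Nat.mod_eq_of_lt (by omega)]
      · exact Nat.mod_eq_of_lt (by omega)
    simp only [h4, h3]
    split_ifs <;> omega

theorem IsMultisun.not_isBalanced_of_induce {V : Type*} [Finite V] {G : SimpleGraph V} {S : Set V}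
    (h : (G.induce S).IsMultisun) : ¬ G.IsBalanced := by
  obtain ⟨e⟩ := h.rim_cycle
  have hn := h.three_le_card
  have : NeZero (Nat.card S) := ⟨by omega⟩
  have hadj : ∀ i, (G.induce S).rim.Adj (e i) (e (i + 1)) := by
    intro i
    rw [e.map_adj_iff, cycleGraph_adj']
    right
    rw [add_sub_cancel_left, Fin.val_one', Nat.mod_eq_of_lt (by omega)]
  refine not_isBalanced_of_cycle hn h.odd_card (fun i => (e i : V))
    (Subtype.val_injective.comp e.injective) ?_ ?_
  · exact fun i => adj_of_mem_maximalCliques (hadj i).2 (Set.mem_insert _ _)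
      (Set.mem_insert_of_mem _ rfl) (hadj i).1
  · exact fun i j => not_adj_of_pair_mem_maximalCliques (z := e j) (hadj i).1 (hadj i).2

end SimpleGraph

theorem mainTheorem1 {V : Type*} [Finite V] (G : SimpleGraph V) (hG : G.IsDiamondFree) :
    ¬ G.IsBalanced ↔
      (G.ContainsOddHole ∨ ∃ S : Set V, (G.induce S).IsSunoid) := by
  constructor
  · exact fun h => Or.inr (hG.exists_isSunoid h)
  · rintro (h | ⟨S, hS⟩)
    · exact h.not_isBalanced
    · exact hS.1.not_isBalanced_of_induce
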